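/- Let $R$ be a (commutative) local ring that is a unique factorization domain of positive Krull dimension, and let $m\le n$. For $A\in Mat_{m\times n}(R)$ let $I_m(A)\subseteq R$ be the ideal generated by all the $m\times m$ minors of $A$. Let $T: Mat_{m\times n}(R)\to Mat_{m\times n}(R)$ be an invertible $R$-linear map such that, for every $A\in Mat_{m\times n}(R)$, $I_m(A)=\{0\}$ if and only if $I_m(T(A))=\{0\}$. Then at least one of the following holds: (1) there exist $U\in GL(m,R)$ and $V\in GL(n,R)$ such that $T(A)=UAV$ for all $A\in Mat_{m\times n}(R)$; (2) $m=n$, and there exist $U,V\in GL(m,R)$ such that $T(A)=UA^{t}V$ for all $A\in Mat_{m\times m}(R)$, where $A^t$ is the transpose of $A$. -/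

import Mathlib

/-- The determinantal ideal `I_j(A)`: the ideal of `R` generated by all `j × j` minors of the
`m × n` matrix `A`. A minor is given by strictly increasing choices of `j` rows and `j` columns,
so that `I_0(A) = R` and `I_j(A) = 0` for `j > min m n`. -/
def determinantalIdeal {R : Type*} [CommRing R] {m n : ℕ} (j : ℕ)
    (A : Matrix (Fin m) (Fin n) R) : Ideal R :=
  Ideal.span {d : R | ∃ (r : Fin j ↪o Fin m) (c : Fin j ↪o Fin n), d = (A.submatrix r c).det}

namespace Matrix

/-! Over a domain, `I_m(A) = 0` means that the rows of `A` are dependent. Rank at most one can be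
read off from this property: a pencil `X + t • A` with `A` of rank at most one is singular for every
`t` or for at most one, while any other `A` has a pencil singular at 0 and 1 but not at a third
scalar (`rankLEOne_iff_leftSingular`). So `T` preserves rank at most one in both directions.

The images of the matrix units then keep the rank-one relations of the units, which over the
fraction field forces them into the form `u i ⊗ v j`, or the same with the factors swapped
(`IsRankOneFrame.exists_forall_eq_vecMulVec`). Locality supplies a unit entry that brings the
factorisation back to `R` (`exists_forall_eq_mul_mul`), and surjectivity makes the factors
invertible. -/

/-- A matrix has a nontrivial linear relation between its rows. -/
def LeftSingular {R m n : Type*} [CommRing R] [Fintype m] (A : Matrix m n R) : Prop :=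
  ∃ x : m → R, x ≠ 0 ∧ x ᵥ* A = 0

/-- All `2 × 2` minors of the matrix vanish. -/
def RankLEOne {R m n : Type*} [CommRing R] (A : Matrix m n R) : Prop :=
  ∀ i i' j j', A i j * A i' j' = A i j' * A i' j

/-! ### Maximal minors and dependence of rows -/

theorem LeftSingular.of_map {R K m n : Type*} [CommRing R] [IsDomain R] [Field K]
    [Algebra R K] [IsFractionRing R K] [Fintype m] {A : Matrix m n R}
    (h : (A.map (algebraMap R K)).LeftSingular) : A.LeftSingular := by
  obtain ⟨x, hx, hxA⟩ := h
  obtain ⟨b, hb⟩ := IsLocalization.exist_integer_multiples_of_finite (nonZeroDivisors R) x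
  choose y hy using hb
  have hb0 : algebraMap R K (b : R) ≠ 0 := by
    simp
  refine ⟨y, ?_, ?_⟩
  · rintro rfl
    apply hx
    ext i
    have := hy i
    simp only [Pi.zero_apply, map_zero, Algebra.smul_def] at this
    exact (mul_eq_zero.1 this.symm).resolve_left hb0
  · ext j
    apply IsFractionRing.injective R K
    have := congrFun hxA j
    simp only [vecMul, dotProduct, map_apply, Pi.zero_apply] at this
    simp only [vecMul, dotProduct, map_sum, map_mul, hy, Algebra.smul_def, mul_assoc,
      ← Finset.mul_sum, this, mul_zero, Pi.zero_apply, map_zero]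

theorem leftSingular_of_det_eq_zero {K : Type*} [Field K] {m n : ℕ} {A : Matrix (Fin m) (Fin n) K}
    (h : ∀ c : Fin m ↪o Fin n, (A.submatrix id c).det = 0) : A.LeftSingular := by
  by_contra hA
  have hrow : LinearIndependent K A.row := by
    rw [← vecMul_injective_iff, ← coe_vecMulLinear, injective_iff_map_eq_zero]
    intro x hx
    by_contra hx0
    exact hA ⟨x, hx0, hx⟩
  have hrank : Module.finrank K (Submodule.span K (Set.range A.col)) = m := by
    rw [← rank_eq_finrank_span_cols, hrow.rank_matrix, Fintype.card_fin]
  obtain ⟨κ, a, ha, hspan, hli⟩ := exists_linearIndependent' K A.col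
  have : Finite κ := Finite.of_injective a ha
  have := Fintype.ofFinite κ
  have hcard : (Finset.univ.map ⟨a, ha⟩).card = m := by
    rw [Finset.card_map, Finset.card_univ, ← finrank_span_eq_card hli, hspan, hrank]
  -- Minors use increasing column choices, so the independent columns are sorted.
  set c := (Finset.univ.map ⟨a, ha⟩).orderEmbOfFin hcard
  have hmem : ∀ i, ∃ k, a k = c i := fun i => by
    obtain ⟨k, -, hk⟩ := Finset.mem_map.1 (Finset.orderEmbOfFin_mem _ hcard i)
    exact ⟨k, hk⟩
  choose k hk using hmem
  have hkinj : Function.Injective k := fun i j hij => by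
    apply c.injective; rw [← hk, ← hk, hij]
  have hcols : LinearIndependent K (A.submatrix id c).col := by
    have : (A.submatrix id c).col = (A.col ∘ a) ∘ k := by
      ext i j
      simp only [Function.comp_apply, hk, col_apply, submatrix_apply, id]
    rw [this]
    exact hli.comp k hkinj
  rw [linearIndependent_cols_iff_isUnit, isUnit_iff_isUnit_det, h c] at hcols
  exact not_isUnit_zero hcols

theorem _root_.determinantalIdeal_eq_bot_iff {R : Type*} [CommRing R] [IsDomain R] {m n : ℕ}
    (A : Matrix (Fin m) (Fin n) R) : determinantalIdeal m A = ⊥ ↔ A.LeftSingular := by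
  rw [determinantalIdeal, Ideal.span_eq_bot]
  constructor
  · intro h
    apply LeftSingular.of_map (K := FractionRing R)
    apply leftSingular_of_det_eq_zero
    intro c
    have := h _ ⟨(OrderIso.refl _).toOrderEmbedding, c, rfl⟩
    rw [submatrix_map, ← RingHom.mapMatrix_apply, ← RingHom.map_det]
    simpa using this
  · rintro ⟨x, hx, hxA⟩ _ ⟨r, c, rfl⟩
    rw [← exists_vecMul_eq_zero_iff]
    have hr : Function.Bijective r := Finite.injective_iff_bijective.1 r.injective
    refine ⟨x ∘ r, fun h => hx ?_, ?_⟩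
    · ext i
      obtain ⟨k, rfl⟩ := hr.2 i
      exact congrFun h k
    · ext j
      have := congrFun hxA (c j)
      simp only [vecMul, dotProduct, Pi.zero_apply] at this
      simpa only [vecMul, dotProduct, Pi.zero_apply, submatrix_apply, Function.comp_apply] using
        (hr.sum_comp fun i => x i * A i (c j)).trans this

/-! ### Rank at most one through singular pencils -/

/-- If `x` kills the pencil at `t`, its image under the nonsingular `X + t₀ • A` is `(t₀ - t) • (x
ᵥ* A)`, proportional to one fixed row of `A`. Two such `x` are therefore proportional, with weights
that determine `t`. -/
theorem RankLEOne.leftSingular_subsingleton {R m n : Type*} [CommRing R] [IsDomain R] [Fintype m]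
    {A : Matrix m n R} (hA : A.RankLEOne) (X : Matrix m n R) {t₀ t₁ t₂ : R}
    (h₀ : ¬ (X + t₀ • A).LeftSingular) (h₁ : (X + t₁ • A).LeftSingular)
    (h₂ : (X + t₂ • A).LeftSingular) : t₁ = t₂ := by
  by_cases hz : A = 0
  · subst hz; simp only [smul_zero] at h₀ h₁; exact absurd h₁ h₀
  obtain ⟨p, q, hpq⟩ : ∃ p q, A p q ≠ 0 := by
    by_contra! h; exact hz (ext h)
  have key : ∀ x : m → R, ∀ t, x ᵥ* (X + t • A) = 0 → ∀ j,
      A p q * (x ᵥ* (X + t₀ • A)) j = (t₀ - t) * (x ⬝ᵥ fun i => A i q) * A p j := by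
    intro x t hx j
    have h1 : (x ᵥ* (X + t₀ • A)) j = (t₀ - t) * (x ᵥ* A) j := by
      have h := congrFun hx j
      simp only [vecMul_add, vecMul_smul, Pi.add_apply, Pi.smul_apply, smul_eq_mul,
        Pi.zero_apply] at h ⊢
      linear_combination h
    have h2 : A p q * (x ᵥ* A) j = (x ⬝ᵥ fun i => A i q) * A p j := by
      simp only [vecMul, dotProduct, Finset.mul_sum, Finset.sum_mul]
      refine Finset.sum_congr rfl fun i _ => ?_
      linear_combination x i * hA p i q j
    rw [h1]; linear_combination (t₀ - t) * h2
  obtain ⟨x, hx0, hx⟩ := h₁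
  obtain ⟨y, hy0, hy⟩ := h₂
  have hne : ∀ x : m → R, x ≠ 0 → ∀ t, x ᵥ* (X + t • A) = 0 →
      (t₀ - t) * (x ⬝ᵥ fun i => A i q) ≠ 0 := by
    intro x hx0 t hx h
    refine h₀ ⟨x, hx0, ?_⟩
    ext j
    have := key x t hx j
    rw [h, zero_mul] at this
    exact (mul_eq_zero.1 this).resolve_left hpq
  have hx' := hne x hx0 t₁ hx
  have hy' := hne y hy0 t₂ hy
  set a := x ⬝ᵥ fun i => A i q with ha
  set b := y ⬝ᵥ fun i => A i q with hb
  have hcomb : ((t₀ - t₂) * b) • x - ((t₀ - t₁) * a) • y = 0 := by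
    by_contra hc
    refine h₀ ⟨_, hc, ?_⟩
    ext j
    have e1 := key x t₁ hx j
    have e2 := key y t₂ hy j
    refine (mul_eq_zero.1 (?_ : A p q * _ = 0)).resolve_left hpq
    simp only [sub_vecMul, smul_vecMul, Pi.sub_apply, Pi.smul_apply, smul_eq_mul]
    linear_combination ((t₀ - t₂) * b) * e1 - ((t₀ - t₁) * a) * e2
  have hd : (t₀ - t₂) * b * a - (t₀ - t₁) * a * b = 0 := by
    have := congrArg (fun z => z ⬝ᵥ fun i => A i q) hcomb
    simpa only [sub_dotProduct, smul_dotProduct, zero_dotProduct, smul_eq_mul] using this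
  have hab : a * b ≠ 0 := mul_ne_zero (right_ne_zero_of_mul hx') (right_ne_zero_of_mul hy')
  refine mul_left_cancel₀ hab ?_
  linear_combination hd

theorem exists_embedding_apply_eq {m n : ℕ} (hmn : m ≤ n) {p p' : Fin m} (hp : p ≠ p')
    {q q' : Fin n} (hq : q ≠ q') : ∃ σ : Fin m → Fin n, σ.Injective ∧ σ p = q ∧ σ p' = q' := by
  set τ := Equiv.swap (Fin.castLE hmn p) q
  have h1 : τ (Fin.castLE hmn p) = q := Equiv.swap_apply_left _ _
  have h2 : τ (Fin.castLE hmn p') ≠ q := by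
    rw [← h1]; exact fun h => hp (Fin.castLE_injective hmn (τ.injective h)).symm
  refine ⟨fun i => Equiv.swap (τ (Fin.castLE hmn p')) q' (τ (Fin.castLE hmn i)), ?_, ?_, ?_⟩
  · exact (Equiv.injective _).comp (τ.injective.comp (Fin.castLE_injective hmn))
  · simp only [h1]; exact Equiv.swap_apply_of_ne_of_ne h2.symm hq
  · exact Equiv.swap_apply_left _ _

theorem exists_leftSingular_of_not_rankLEOne {R : Type*} [CommRing R] [IsDomain R] {m n : ℕ}
    (hmn : m ≤ n) {t : R} (ht0 : t ≠ 0) (ht1 : t ≠ 1) {A : Matrix (Fin m) (Fin n) R}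
    (hA : ¬ A.RankLEOne) : ∃ X : Matrix (Fin m) (Fin n) R, ¬ (X + t • A).LeftSingular ∧
      (X + (0 : R) • A).LeftSingular ∧ (X + (1 : R) • A).LeftSingular := by
  simp only [RankLEOne, not_forall] at hA
  obtain ⟨p, p', q, q', h⟩ := hA
  have hp : p ≠ p' := by rintro rfl; exact h (mul_comm _ _)
  have hq : q ≠ q' := by rintro rfl; exact h rfl
  obtain ⟨σ, hσ, rfl, rfl⟩ := exists_embedding_apply_eq hmn hp hq
  -- Row `p` of the pencil vanishes at 0 and row `p'` at 1. At `t` these rows are nonzero multiples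
  -- of those of `A`, and every other row `i` is the unit vector at `σ i`.
  refine ⟨of fun i j => if i = p then 0 else if i = p' then - A p' j else
    - t * A i j + (if j = σ i then 1 else 0), ?_, ?_, ?_⟩
  · rintro ⟨x, hx0, hx⟩
    have hcol : ∀ j, x p * (t * A p j) + x p' * ((t - 1) * A p' j) +
        ∑ i, (if i = p ∨ i = p' then 0 else if j = σ i then x i else 0) = 0 := by
      intro j
      refine Eq.trans ?_ (congrFun hx j)
      simp only [vecMul, dotProduct]
      rw [← Finset.add_sum_erase _ _ (Finset.mem_univ p),
        ← Finset.add_sum_erase _ _ (Finset.mem_erase.2 ⟨hp.symm, Finset.mem_univ p'⟩),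
        ← Finset.add_sum_erase (f := fun i => x i * _) _ (Finset.mem_univ p),
        ← Finset.add_sum_erase (f := fun i => x i * _) _
          (Finset.mem_erase.2 ⟨hp.symm, Finset.mem_univ p'⟩)]
      have : ∀ i ∈ (Finset.univ.erase p).erase p',
          (if i = p ∨ i = p' then 0 else if j = σ i then x i else 0) =
          x i * ((of fun i j => if i = p then 0 else if i = p' then - A p' j else
            - t * A i j + (if j = σ i then 1 else 0)) + t • A) i j := by
        intro i hi
        simp only [Finset.mem_erase, Finset.mem_univ, and_true] at hi
        simp [hi.1, hi.2]
      rw [Finset.sum_congr rfl this]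
      simp [hp.symm]
      ring
    have hz : ∀ k, k = p ∨ k = p' →
        ∑ i, (if i = p ∨ i = p' then 0 else if σ k = σ i then x i else 0) = 0 := by
      intro k hk
      refine Finset.sum_eq_zero fun i _ => ?_
      split_ifs with h1 h2
      · rfl
      · exact absurd (hσ h2 ▸ hk) h1
      · rfl
    -- Columns `σ p` and `σ p'` involve only `x p` and `x p'`; Cramer's rule with the nonzero minor
    -- kills both.
    have e1 := hcol (σ p)
    have e2 := hcol (σ p')
    rw [hz _ (.inl rfl), add_zero] at e1
    rw [hz _ (.inr rfl), add_zero] at e2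
    have hdet := sub_ne_zero.2 h
    have ht1' := sub_ne_zero.2 ht1
    have xp : x p = 0 := by
      refine (mul_eq_zero.1 (?_ : _ * x p = 0)).resolve_left (mul_ne_zero ht0 hdet)
      linear_combination A p' (σ p') * e1 - A p' (σ p) * e2
    have xp' : x p' = 0 := by
      refine (mul_eq_zero.1 (?_ : _ * x p' = 0)).resolve_left (mul_ne_zero ht1' hdet)
      linear_combination A p (σ p) * e2 - A p (σ p') * e1
    refine hx0 (funext fun k => ?_)
    by_cases hk : k = p ∨ k = p'
    · rcases hk with rfl | rfl <;> assumption
    · have := hcol (σ k)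
      rw [xp, xp', zero_mul, zero_mul, zero_add, zero_add, Finset.sum_eq_single k] at this
      · simpa [hk] using this
      · intro i _ hik
        rw [if_neg (c := σ k = σ i) fun h => hik (hσ h).symm, ite_self]
      · simp
  · refine ⟨Pi.single p 1, by simp, ?_⟩
    ext j; simp
  · refine ⟨Pi.single p' 1, by simp, ?_⟩
    ext j; simp [hp.symm]

theorem rankLEOne_iff_leftSingular {R : Type*} [CommRing R] [IsDomain R] {m n : ℕ}
    (hmn : m ≤ n) {t : R} (ht0 : t ≠ 0) (ht1 : t ≠ 1) (A : Matrix (Fin m) (Fin n) R) :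
    A.RankLEOne ↔ ∀ (X : Matrix (Fin m) (Fin n) R) (t₀ t₁ t₂ : R),
      ¬ (X + t₀ • A).LeftSingular → (X + t₁ • A).LeftSingular → (X + t₂ • A).LeftSingular →
        t₁ = t₂ := by
  refine ⟨fun hA X t₀ t₁ t₂ => hA.leftSingular_subsingleton X, fun h => ?_⟩
  by_contra hA
  obtain ⟨X, h0, h1, h2⟩ := exists_leftSingular_of_not_rankLEOne hmn ht0 ht1 hA
  exact zero_ne_one (h X _ _ _ h0 h1 h2)

theorem rankLEOne_map_linearEquiv {R : Type*} [CommRing R] [IsDomain R] {m n : ℕ}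
    (hmn : m ≤ n) {t : R} (ht0 : t ≠ 0) (ht1 : t ≠ 1)
    (T : Matrix (Fin m) (Fin n) R ≃ₗ[R] Matrix (Fin m) (Fin n) R)
    (hT : ∀ A, A.LeftSingular ↔ (T A).LeftSingular) (A : Matrix (Fin m) (Fin n) R) :
    A.RankLEOne ↔ (T A).RankLEOne := by
  rw [rankLEOne_iff_leftSingular hmn ht0 ht1 A, rankLEOne_iff_leftSingular hmn ht0 ht1 (T A)]
  refine Iff.trans ?_ T.surjective.forall.symm
  simp only [← map_smul, ← map_add, ← hT]

end Matrix
namespace Matrix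

/-! ### Rank-one frames over a field -/

/-- Two vectors are parallel: all `2 × 2` minors of the pair vanish. -/
def Parallel {R p : Type*} [CommRing R] (x y : p → R) : Prop :=
  ∀ k l, x k * y l = x l * y k

theorem Parallel.symm {R p : Type*} [CommRing R] {x y : p → R} (h : Parallel x y) :
    Parallel y x := fun k l => by linear_combination h l k

theorem Parallel.trans {R p : Type*} [CommRing R] [IsDomain R] {x y z : p → R} (hy : y ≠ 0)
    (h : Parallel x y) (h' : Parallel y z) : Parallel x z := by
  obtain ⟨i, hi⟩ := Function.ne_iff.1 hy
  intro k l
  refine mul_left_cancel₀ (pow_ne_zero 2 hi) ?_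
  linear_combination (z l * y i) * h k i - (z k * y i) * h l i + (x i * y k) * h' i l -
    (x i * y l) * h' i k

theorem Parallel.exists_smul_eq {K p : Type*} [Field K] {x y : p → K} (hy : y ≠ 0)
    (h : Parallel x y) : ∃ c : K, x = c • y := by
  obtain ⟨i, hi⟩ := Function.ne_iff.1 hy
  refine ⟨x i / y i, funext fun k => ?_⟩
  have hi' : y i ≠ 0 := hi
  simp only [Pi.smul_apply, smul_eq_mul]
  field_simp
  linear_combination h k i

theorem RankLEOne.exists_eq_vecMulVec {K p q : Type*} [Field K] {A : Matrix p q K}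
    (h : A.RankLEOne) : ∃ x y, A = vecMulVec x y := by
  by_cases hz : A = 0
  · exact ⟨0, 0, by simp [hz]⟩
  obtain ⟨i, j, hij⟩ : ∃ i j, A i j ≠ 0 := by
    by_contra! h; exact hz (ext h)
  refine ⟨fun k => A k j, fun l => A i l / A i j, ext fun k l => ?_⟩
  simp only [vecMulVec_apply]
  field_simp
  linear_combination h k i l j

/-- Each 2 × 2 minor of the sum is a minor of `(x, x')` times a minor of `(y, y')`. -/
theorem rankLEOne_vecMulVec_add_iff {R p q : Type*} [CommRing R] [IsDomain R]
    (x x' : p → R) (y y' : q → R) :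
    (vecMulVec x y + vecMulVec x' y').RankLEOne ↔ Parallel x x' ∨ Parallel y y' := by
  have key : ∀ i i' j j', (vecMulVec x y + vecMulVec x' y') i j *
      (vecMulVec x y + vecMulVec x' y') i' j' - (vecMulVec x y + vecMulVec x' y') i j' *
      (vecMulVec x y + vecMulVec x' y') i' j =
      (x i * x' i' - x i' * x' i) * (y j * y' j' - y j' * y' j) := by
    intro i i' j j'
    simp only [add_apply, vecMulVec_apply]
    ring
  constructor
  · intro h
    by_contra! hc
    simp only [Parallel, not_forall] at hc
    obtain ⟨⟨i, i', hi⟩, j, j', hj⟩ := hc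
    have := key i i' j j'
    rw [sub_eq_zero.2 (h i i' j j')] at this
    exact mul_ne_zero (sub_ne_zero.2 hi) (sub_ne_zero.2 hj) this.symm
  · intro h i i' j j'
    rw [← sub_eq_zero, key]
    rcases h with h | h
    · rw [sub_eq_zero.2 (h i i'), zero_mul]
    · rw [sub_eq_zero.2 (h j j'), mul_zero]

/-- A family of matrices behaving, with regard to rank at most one, like the matrix units. -/
structure IsRankOneFrame {K m n p q : Type*} [CommRing K] (F : m → n → Matrix p q K) : Prop where
  rankLEOne : ∀ i j, (F i j).RankLEOne
  ne_zero : ∀ i j, F i j ≠ 0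
  row : ∀ i j k, (F i j + F i k).RankLEOne
  col : ∀ i l j, (F i j + F l j).RankLEOne
  diag : ∀ i l j k, i ≠ l → j ≠ k → ¬ (F i j + F l k).RankLEOne
  square : ∀ i l j k, (F i j + F l k + (F i k + F l j)).RankLEOne

theorem RankLEOne.transpose {R m n : Type*} [CommRing R] {A : Matrix m n R} (h : A.RankLEOne) :
    Aᵀ.RankLEOne := fun i i' j j' => by
  simp only [transpose_apply]
  linear_combination h j j' i i'

theorem IsRankOneFrame.transpose {K m n p q : Type*} [CommRing K] {F : m → n → Matrix p q K}
    (hF : IsRankOneFrame F) : IsRankOneFrame fun i j => (F i j)ᵀ where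
  rankLEOne i j := (hF.rankLEOne i j).transpose
  ne_zero i j h := hF.ne_zero i j (transpose_eq_zero.1 h)
  row i j k := (hF.row i j k).transpose
  col i l j := (hF.col i l j).transpose
  diag i l j k hi hj h := hF.diag i l j k hi hj h.transpose
  square i l j k := (hF.square i l j k).transpose

theorem IsRankOneFrame.vec_ne_zero {K m n p q : Type*} [CommRing K] {F : m → n → Matrix p q K}
    (hF : IsRankOneFrame F) {a : m → n → p → K} {b : m → n → q → K}
    (hab : ∀ i j, F i j = vecMulVec (a i j) (b i j)) :
    (∀ i j, a i j ≠ 0) ∧ ∀ i j, b i j ≠ 0 := by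
  constructor <;> intro i j h <;> refine hF.ne_zero i j (ext fun k l => ?_) <;>
    simp [hab, h, vecMulVec_apply]

theorem IsRankOneFrame.not_parallel {K m n p q : Type*} [CommRing K] [IsDomain K]
    {F : m → n → Matrix p q K} (hF : IsRankOneFrame F) {a : m → n → p → K} {b : m → n → q → K}
    (hab : ∀ i j, F i j = vecMulVec (a i j) (b i j)) (i l : m) (j k : n) (hi : i ≠ l)
    (hj : j ≠ k) : ¬ Parallel (a i j) (a l k) ∧ ¬ Parallel (b i j) (b l k) := by
  have := hF.diag i l j k hi hj
  rwa [hab, hab, rankLEOne_vecMulVec_add_iff, not_or] at this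

theorem exists_eq_mul_of_minors_eq_zero {K m n : Type*} [Field K] [Nonempty m] [Nonempty n]
    {c : m → n → K} (hc : ∀ i j, c i j ≠ 0)
    (h : ∀ i l j k, i ≠ l → j ≠ k → c i j * c l k = c i k * c l j) :
    ∃ (d : m → K) (e : n → K), ∀ i j, c i j = d i * e j := by
  obtain ⟨i₀⟩ := ‹Nonempty m›
  obtain ⟨j₀⟩ := ‹Nonempty n›
  refine ⟨fun i => c i j₀, fun j => c i₀ j / c i₀ j₀, fun i j => ?_⟩
  have := hc i₀ j₀
  field_simp
  by_cases hi : i = i₀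
  · subst hi; ring
  by_cases hj : j = j₀
  · subst hj; ring
  exact h i i₀ j j₀ hi hj

/-- Parallelism gives the form `c i j • (u i ⊗ v j)`; the `square` condition makes the 2 × 2 minors
of `c` vanish, so `c` splits and is absorbed into the vectors. -/
theorem exists_forall_eq_vecMulVec_of_parallel {K m n p q : Type*} [Field K] [Nontrivial m]
    [Nontrivial n] {F : m → n → Matrix p q K} (hF : IsRankOneFrame F) {a : m → n → p → K}
    {b : m → n → q → K} (hab : ∀ i j, F i j = vecMulVec (a i j) (b i j))
    (ha : ∀ i j k, Parallel (a i j) (a i k)) (hb : ∀ i l j, Parallel (b i j) (b l j)) :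
    ∃ (u : m → p → K) (v : n → q → K), ∀ i j, F i j = vecMulVec (u i) (v j) := by
  obtain ⟨ha0, hb0⟩ := hF.vec_ne_zero hab
  obtain ⟨i₀⟩ : Nonempty m := inferInstance
  obtain ⟨j₀⟩ : Nonempty n := inferInstance
  choose r hr using fun i j => (ha i j j₀).exists_smul_eq (ha0 i j₀)
  choose s hs using fun i j => (hb i i₀ j).exists_smul_eq (hb0 i₀ j)
  have hF' : ∀ i j, F i j = (r i j * s i j) • vecMulVec (a i j₀) (b i₀ j) := by
    intro i j
    rw [hab, hr, hs]
    ext k l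
    simp only [vecMulVec_apply, smul_apply, Pi.smul_apply, smul_eq_mul]
    ring
  have hndiag := hF.not_parallel hab
  have hc0 : ∀ i j, r i j * s i j ≠ 0 := fun i j h => hF.ne_zero i j (by rw [hF', h, zero_smul])
  obtain ⟨d, e, hde⟩ := exists_eq_mul_of_minors_eq_zero hc0 (by
    intro i l j k hi hj
    have hna : ¬ Parallel (a i j₀) (a l j₀) := fun h => (hndiag i l j k hi hj).1
      (((ha i j j₀).trans (ha0 _ _) h).trans (ha0 _ _) (ha l j₀ k))
    have hnb : ¬ Parallel (b i₀ j) (b i₀ k) := fun h => (hndiag i l j k hi hj).2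
      (((hb i i₀ j).trans (hb0 _ _) h).trans (hb0 _ _) (hb i₀ l k))
    simp only [Parallel, not_forall] at hna hnb
    obtain ⟨x, x', hx⟩ := hna
    obtain ⟨y, y', hy⟩ := hnb
    have := hF.square i l j k x x' y y'
    simp only [hF', add_apply, smul_apply, vecMulVec_apply, smul_eq_mul] at this
    refine mul_left_cancel₀ (mul_ne_zero (sub_ne_zero.2 hx) (sub_ne_zero.2 hy)) ?_
    linear_combination this)
  refine ⟨fun i => d i • a i j₀, fun j => e j • b i₀ j, fun i j => ?_⟩
  rw [hF', hde]
  ext k l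
  simp only [vecMulVec_apply, smul_apply, Pi.smul_apply, smul_eq_mul]
  ring

/-- One aligned pair decides the type of the whole frame: left factors aligned along a row force
right factors aligned along the crossing columns, and conversely, since otherwise a `diag` pair
would be parallel. -/
theorem forall_parallel_of_parallel {K m n p q : Type*} [Field K]
    {F : m → n → Matrix p q K} (hF : IsRankOneFrame F) {a : m → n → p → K}
    {b : m → n → q → K} (hab : ∀ i j, F i j = vecMulVec (a i j) (b i j))
    {i₀ i₁ : m} (hi : i₁ ≠ i₀) {j₀ j₁ : n} (hj : j₁ ≠ j₀)
    (h₀ : Parallel (a i₀ j₀) (a i₀ j₁)) :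
    (∀ i j k, Parallel (a i j) (a i k)) ∧ ∀ i l j, Parallel (b i j) (b l j) := by
  obtain ⟨ha0, hb0⟩ := hF.vec_ne_zero hab
  have hndiag := hF.not_parallel hab
  have hrow : ∀ i j k, Parallel (a i j) (a i k) ∨ Parallel (b i j) (b i k) := by
    intro i j k
    rw [← rankLEOne_vecMulVec_add_iff, ← hab, ← hab]
    exact hF.row i j k
  have hcol : ∀ i l j, Parallel (a i j) (a l j) ∨ Parallel (b i j) (b l j) := by
    intro i l j
    rw [← rankLEOne_vecMulVec_add_iff, ← hab, ← hab]
    exact hF.col i l j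
  have step : ∀ i l j k, i ≠ l → j ≠ k → Parallel (a i j) (a i k) →
      Parallel (b i j) (b l j) := by
    intro i l j k hi hj h
    refine (hcol i l j).resolve_left fun h' => (hndiag i l k j hi hj.symm).1 ?_
    exact h.symm.trans (ha0 _ _) h'
  have step' : ∀ i l j k, i ≠ l → j ≠ k → Parallel (b i j) (b l j) →
      Parallel (a i j) (a i k) := by
    intro i l j k hi hj h
    refine (hrow i j k).resolve_right fun h' => (hndiag i l k j hi hj.symm).2 ?_
    exact h'.symm.trans (hb0 _ _) h
  have row₀ : ∀ l k, Parallel (a l j₀) (a l k) := by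
    intro l k
    by_cases hk : k = j₀
    · subst hk; exact fun _ _ => mul_comm _ _
    by_cases hl : l = i₀
    · subst hl
      exact step' l i₁ j₀ k hi.symm (Ne.symm hk) (step l i₁ j₀ j₁ hi.symm hj.symm h₀)
    · exact step' l i₀ j₀ k hl (Ne.symm hk)
        (step i₀ l j₀ j₁ (Ne.symm hl) hj.symm h₀).symm
  have row : ∀ i j k, Parallel (a i j) (a i k) := fun i j k =>
    (row₀ i j).symm.trans (ha0 _ _) (row₀ i k)
  refine ⟨row, fun i l j => ?_⟩
  by_cases hil : i = l
  · subst hil; exact fun _ _ => mul_comm _ _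
  by_cases hjj : j = j₀
  · subst hjj; exact step i l j j₁ hil hj.symm (row _ _ _)
  · exact step i l j j₀ hil hjj (row _ _ _)

theorem IsRankOneFrame.exists_forall_eq_vecMulVec {K m n p q : Type*} [Field K] [Nontrivial m]
    [Nontrivial n] {F : m → n → Matrix p q K} (hF : IsRankOneFrame F) :
    (∃ (u : m → p → K) (v : n → q → K), ∀ i j, F i j = vecMulVec (u i) (v j)) ∨
    ∃ (u : m → q → K) (v : n → p → K), ∀ i j, F i j = vecMulVec (v j) (u i) := by
  choose a b hab using fun i j => (hF.rankLEOne i j).exists_eq_vecMulVec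
  obtain ⟨i₁, i₀, hi⟩ := exists_pair_ne m
  obtain ⟨j₁, j₀, hj⟩ := exists_pair_ne n
  have h := hF.row i₀ j₀ j₁
  rw [hab, hab, rankLEOne_vecMulVec_add_iff] at h
  rcases h with h | h
  · obtain ⟨h1, h2⟩ := forall_parallel_of_parallel hF hab hi hj h
    exact .inl (exists_forall_eq_vecMulVec_of_parallel hF hab h1 h2)
  · have hba : ∀ i j, (F i j)ᵀ = vecMulVec (b i j) (a i j) := fun i j => by
      rw [hab, transpose_vecMulVec]
    obtain ⟨h1, h2⟩ := forall_parallel_of_parallel hF.transpose hba hi hj h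
    obtain ⟨u, v, huv⟩ := exists_forall_eq_vecMulVec_of_parallel hF.transpose hba h1 h2
    refine .inr ⟨u, v, fun i j => ?_⟩
    rw [← transpose_inj, huv, transpose_vecMulVec]

/-! ### Images of matrix units and descent to the local ring -/

theorem rankLEOne_map_iff {R K m n : Type*} [CommRing R] [CommRing K] {f : R →+* K}
    (hf : Function.Injective f) {A : Matrix m n R} : (A.map f).RankLEOne ↔ A.RankLEOne := by
  simp only [RankLEOne, map_apply, ← map_mul, hf.eq_iff]

theorem rankLEOne_vecMulVec {R m n : Type*} [CommRing R] (x : m → R) (y : n → R) :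
    (vecMulVec x y).RankLEOne := fun i i' j j' => by
  simp only [vecMulVec_apply]; ring

theorem isRankOneFrame_map_single {R K m n p q : Type*} [CommRing R] [IsDomain R] [Field K]
    [Algebra R K] [IsFractionRing R K] [DecidableEq m] [DecidableEq n]
    (T : Matrix m n R →ₗ[R] Matrix p q R) (hinj : Function.Injective T)
    (hT : ∀ A, A.RankLEOne ↔ (T A).RankLEOne) :
    IsRankOneFrame fun i j => (T (single i j 1)).map (algebraMap R K) := by
  have hf := IsFractionRing.injective R K
  have hsingle : ∀ i j, (single i j 1 : Matrix m n R) = vecMulVec (Pi.single i 1) (Pi.single j 1) :=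
    fun i j => single_eq_single_vecMulVec_single i j
  refine ⟨fun i j => ?_, fun i j h => ?_, fun i j k => ?_, fun i l j => ?_,
    fun i l j k hi hj h => ?_, fun i l j k => ?_⟩
  · rw [rankLEOne_map_iff hf, ← hT, hsingle]
    exact rankLEOne_vecMulVec _ _
  · have h0 : T (single i j 1) = 0 := by
      ext k l
      apply hf
      simpa using congrFun (congrFun h k) l
    have := congrFun (congrFun (hinj (h0.trans (map_zero T).symm)) i) j
    simp at this
  · rw [← Matrix.map_add _ (map_add _), rankLEOne_map_iff hf, ← map_add, ← hT, hsingle, hsingle,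
      ← vecMulVec_add]
    exact rankLEOne_vecMulVec _ _
  · rw [← Matrix.map_add _ (map_add _), rankLEOne_map_iff hf, ← map_add, ← hT, hsingle, hsingle,
      ← add_vecMulVec]
    exact rankLEOne_vecMulVec _ _
  · rw [← Matrix.map_add _ (map_add _), rankLEOne_map_iff hf, ← map_add, ← hT] at h
    have := h i l j k
    simp [hi, hj, hi.symm, hj.symm] at this
  · rw [← Matrix.map_add _ (map_add _), ← Matrix.map_add _ (map_add _),
      ← Matrix.map_add _ (map_add _), rankLEOne_map_iff hf, ← map_add, ← map_add, ← map_add, ← hT]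
    have : (single i j 1 + single l k 1 + (single i k 1 + single l j 1) : Matrix m n R) =
        vecMulVec (Pi.single i 1 + Pi.single l 1) (Pi.single j 1 + Pi.single k 1) := by
      simp only [hsingle, vecMulVec_add, add_vecMulVec]
      abel
    rw [this]
    exact rankLEOne_vecMulVec _ _

theorem linearMap_apply_apply {R m n p q : Type*} [CommRing R] [Fintype m] [Fintype n]
    [DecidableEq m] [DecidableEq n] (T : Matrix m n R →ₗ[R] Matrix p q R) (A : Matrix m n R)
    (k : p) (l : q) : T A k l = ∑ i, ∑ j, A i j * T (single i j 1) k l := by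
  conv_lhs => rw [matrix_eq_sum_single A]
  simp only [map_sum, sum_apply]
  refine Finset.sum_congr rfl fun i _ => Finset.sum_congr rfl fun j _ => ?_
  rw [← mul_one (A i j), ← smul_eq_mul, ← smul_single, map_smul]
  simp

theorem exists_isUnit_apply_single {R m n p q : Type*} [CommRing R] [IsLocalRing R] [Fintype m]
    [Fintype n] [DecidableEq m] [DecidableEq n] [DecidableEq p] [DecidableEq q] [Nonempty p]
    [Nonempty q] (T : Matrix m n R →ₗ[R] Matrix p q R) (hT : Function.Surjective T) :
    ∃ i j k l, IsUnit (T (single i j 1) k l) := by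
  by_contra! h
  obtain ⟨k⟩ := ‹Nonempty p›
  obtain ⟨l⟩ := ‹Nonempty q›
  obtain ⟨A, hA⟩ := hT (single k l 1)
  have h1 := linearMap_apply_apply T A k l
  rw [hA, single_apply_same] at h1
  have : (1 : R) ∈ IsLocalRing.maximalIdeal R := by
    rw [h1]
    exact Ideal.sum_mem _ fun i _ => Ideal.sum_mem _ fun j _ => Ideal.mul_mem_left _ _ (h i j k l)
  exact (Ideal.ne_top_iff_one _).1 (IsLocalRing.maximalIdeal.isMaximal R).ne_top this

theorem exists_forall_eq_mul_mul {R m n p q : Type*} [CommRing R] [IsLocalRing R] [Fintype m]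
    [Fintype n] [DecidableEq m] [DecidableEq n] [DecidableEq p] [DecidableEq q] [Nonempty p]
    [Nonempty q] (T : Matrix m n R →ₗ[R] Matrix p q R) (hT : Function.Surjective T)
    {K : Type*} [Field K] [Algebra R K] (hK : Function.Injective (algebraMap R K))
    {u : m → p → K} {v : n → q → K}
    (huv : ∀ i j, (T (single i j 1)).map (algebraMap R K) = vecMulVec (u i) (v j)) :
    ∃ (U : Matrix p m R) (V : Matrix n q R), ∀ A, T A = U * A * V := by
  obtain ⟨i₀, j₀, k₀, l₀, w, hw⟩ := exists_isUnit_apply_single T hT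
  have key : ∀ i j k l, T (single i j 1) k l * w =
      T (single i j₀ 1) k l₀ * T (single i₀ j 1) k₀ l := by
    intro i j k l
    rw [hw]
    apply hK
    have h := fun i j k l => congrFun (congrFun (huv i j) k) l
    simp only [map_apply, vecMulVec_apply] at h
    simp only [map_mul, h]
    ring
  -- By `key`, the entries through the unit `w` determine all others, with no division in `K`.
  refine ⟨of fun k i => T (single i j₀ 1) k l₀, of fun j l => T (single i₀ j 1) k₀ l * ↑w⁻¹,
    fun A => ext fun k l => ?_⟩
  rw [linearMap_apply_apply, Finset.sum_comm]
  simp only [mul_apply, of_apply, Finset.sum_mul]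
  refine Finset.sum_congr rfl fun j _ => Finset.sum_congr rfl fun i _ => ?_
  rw [← w.mul_inv_cancel_right (T (single i j 1) k l), key]
  ring

theorem exists_mul_eq_one_of_surjective {R m n p q : Type*} [CommRing R] [Fintype m] [Fintype n]
    [DecidableEq p] [DecidableEq q] [Nonempty p] [Nonempty q] {U : Matrix p m R}
    {V : Matrix n q R} (h : ∀ B : Matrix p q R, ∃ A : Matrix m n R, U * A * V = B) :
    (∃ U' : Matrix m p R, U * U' = 1) ∧ ∃ V' : Matrix q n R, V' * V = 1 := by
  choose S hS using h
  obtain ⟨k⟩ := ‹Nonempty p›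
  obtain ⟨l⟩ := ‹Nonempty q›
  constructor
  · refine ⟨of fun i k' => (S (single k' l 1) * V) i l, ext fun a b => ?_⟩
    have := congrFun (congrFun (hS (single b l 1)) a) l
    rw [Matrix.mul_assoc, mul_apply] at this
    rw [mul_apply, one_apply]
    simpa [single_apply, eq_comm] using this
  · refine ⟨of fun l' j => (U * S (single k l' 1)) k j, ext fun a b => ?_⟩
    have := congrFun (congrFun (hS (single k a 1)) k) b
    rw [mul_apply] at this
    rw [mul_apply, one_apply]
    simpa [single_apply] using this

theorem card_le_of_mul_eq_one {R m n : Type*} [CommRing R] [Nontrivial R] [Fintype m] [Fintype n]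
    [DecidableEq n] {A : Matrix n m R} {B : Matrix m n R} (h : A * B = 1) :
    Fintype.card n ≤ Fintype.card m := by
  calc Fintype.card n = (A * B).rank := by rw [h, rank_one]
    _ ≤ A.rank := rank_mul_le_left A B
    _ ≤ Fintype.card m := rank_le_card_width A

/-- A square matrix with a right inverse, as an element of the general linear group. -/
noncomputable def glOfMulEqOne {R m : Type*} [CommRing R] [Fintype m] [DecidableEq m]
    (U U' : Matrix m m R) (h : U * U' = 1) : GeneralLinearGroup m R :=
  ⟨U, U', h, mul_eq_one_comm.1 h⟩

end Matrix

/-- The pencil criterion needs a third scalar; positive dimension serves to provide it. -/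
theorem exists_ne_zero_ne_one_of_not_isField {R : Type*} [CommRing R] [Nontrivial R]
    (h : ¬ IsField R) : ∃ t : R, t ≠ 0 ∧ t ≠ 1 := by
  by_contra! hc
  exact h ⟨⟨0, 1, zero_ne_one⟩, mul_comm, fun {a} ha => ⟨1, by rw [hc a ha, mul_one]⟩⟩

open Matrix in
theorem mainTheorem9 {R : Type*} [CommRing R] [IsDomain R] [UniqueFactorizationMonoid R]
    [IsLocalRing R] (hdim : 0 < ringKrullDim R) (m n : ℕ) (hmn : m ≤ n)
    (T : Matrix (Fin m) (Fin n) R ≃ₗ[R] Matrix (Fin m) (Fin n) R)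
    (hT : ∀ A : Matrix (Fin m) (Fin n) R,
      determinantalIdeal m A = ⊥ ↔ determinantalIdeal m (T A) = ⊥) :
    (∃ (U : Matrix.GeneralLinearGroup (Fin m) R) (V : Matrix.GeneralLinearGroup (Fin n) R),
      ∀ A : Matrix (Fin m) (Fin n) R,
        T A = (U : Matrix (Fin m) (Fin m) R) * A * (V : Matrix (Fin n) (Fin n) R)) ∨
    (∃ (h : m = n) (U : Matrix.GeneralLinearGroup (Fin m) R)
      (V : Matrix.GeneralLinearGroup (Fin n) R),
      ∀ A : Matrix (Fin m) (Fin n) R,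
        T A = (U : Matrix (Fin m) (Fin m) R) *
          (A.transpose.submatrix (Fin.cast h) (Fin.cast h.symm)) *
          (V : Matrix (Fin n) (Fin n) R)) := by
  have hfield : ¬ IsField R := fun h => by
    rw [ringKrullDim_eq_zero_of_isField h] at hdim
    exact lt_irrefl _ hdim
  obtain ⟨t, ht0, ht1⟩ := exists_ne_zero_ne_one_of_not_isField hfield
  rcases Nat.eq_zero_or_pos m with rfl | hm
  · exact .inl ⟨1, 1, fun A => Subsingleton.elim _ _⟩
  have hn : 0 < n := hm.trans_le hmn
  have : Nonempty (Fin m) := ⟨⟨0, hm⟩⟩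
  have : Nonempty (Fin n) := ⟨⟨0, hn⟩⟩
  have finish : ∀ (U : Matrix (Fin m) (Fin m) R) (V : Matrix (Fin n) (Fin n) R),
      (∀ A, T A = U * A * V) →
      ∃ (U : Matrix.GeneralLinearGroup (Fin m) R) (V : Matrix.GeneralLinearGroup (Fin n) R),
        ∀ A, T A = (U : Matrix (Fin m) (Fin m) R) * A * (V : Matrix (Fin n) (Fin n) R) := by
    intro U V h
    obtain ⟨⟨U', hU⟩, V', hV⟩ := exists_mul_eq_one_of_surjective (U := U) (V := V) fun B =>
      ⟨T.symm B, by rw [← h, T.apply_symm_apply]⟩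
    exact ⟨glOfMulEqOne U U' hU, glOfMulEqOne V V' (mul_eq_one_comm.1 hV), h⟩
  -- With a single row, `T` is already right multiplication by a matrix; frames need two rows and
  -- two columns.
  rcases Nat.eq_or_lt_of_le hm with rfl | hm2
  · left
    apply finish 1 (of fun j l => T (single 0 j 1) 0 l)
    intro A
    ext k l
    rw [← LinearEquiv.coe_coe, linearMap_apply_apply]
    simp [mul_apply, Subsingleton.elim k 0]
  have : Nontrivial (Fin m) := Fin.nontrivial_iff_two_le.2 hm2
  have : Nontrivial (Fin n) := Fin.nontrivial_iff_two_le.2 (le_trans hm2 hmn)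
  simp only [determinantalIdeal_eq_bot_iff] at hT
  have hframe := isRankOneFrame_map_single (K := FractionRing R) T.toLinearMap T.injective
    (rankLEOne_map_linearEquiv hmn ht0 ht1 T hT)
  have hK := IsFractionRing.injective R (FractionRing R)
  rcases hframe.exists_forall_eq_vecMulVec with ⟨u, v, huv⟩ | ⟨u, v, huv⟩
  · obtain ⟨U, V, hUV⟩ := exists_forall_eq_mul_mul T.toLinearMap T.surjective hK huv
    exact .inl (finish U V hUV)
  -- Composing with transposition reduces the swapped case to the first form.
  · set T' := T.trans (transposeLinearEquiv (Fin m) (Fin n) R R)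
    have huv' : ∀ i j, (T'.toLinearMap (single i j 1)).map (algebraMap R (FractionRing R)) =
        vecMulVec (u i) (v j) := by
      intro i j
      rw [← transpose_inj, transpose_vecMulVec, ← huv]
      rfl
    obtain ⟨V, U, hUV⟩ := exists_forall_eq_mul_mul T'.toLinearMap T'.surjective hK huv'
    have hUV' : ∀ A, T A = Uᵀ * Aᵀ * Vᵀ := by
      intro A
      rw [← transpose_inj, Matrix.mul_assoc, transpose_mul, transpose_mul]
      simp only [transpose_transpose]
      exact hUV A
    obtain ⟨⟨U', hU⟩, V', hV⟩ := exists_mul_eq_one_of_surjective (U := Uᵀ) (V := Vᵀ) fun B =>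
      ⟨(T.symm B)ᵀ, by rw [← hUV', T.apply_symm_apply]⟩
    -- The `m × n` matrix `Vᵀ` has a left inverse, which forces the matrices to be square.
    have hnm : n ≤ m := by simpa using card_le_of_mul_eq_one hV
    obtain rfl : m = n := le_antisymm hmn hnm
    exact .inr ⟨rfl, glOfMulEqOne _ U' hU, glOfMulEqOne _ V' (mul_eq_one_comm.1 hV), hUV'⟩
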